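/- All graphs are finite and simple. For a connected graph $G$ let $d_G(u,v)$ be the number of edges of a shortest path from $u$ to $v$. The Harary matrix of $G$ is the real symmetric matrix indexed by $V(G)$ with entry $1/d_G(u,v)$ for $u\neq v$ and $0$ on the diagonal; the Harary spectral radius $\rho(G)$ is the largest absolute value of an eigenvalue of this matrix. A cut edge of a connected graph is an edge whose deletion disconnects it. For $t\ge 1$ and $p\ge 0$ let $K_t(p)$ be the graph obtained from the complete graph $K_t$ by attaching $p$ pendant edges at one and the same vertex. Theorem 5.3. Let $n,p$ be non-negative integers for which there is a connected graph on $n$ vertices with exactly $p$ cut edges. Then $p<n$, and $K_{n-p}(p)$ is, up to isomorphism, the unique graph with maximum Harary spectral radius among connected graphs on $n$ vertices with exactly $p$ cut edges. That is, $K_{n-p}(p)$ is itself a connected graph on $n$ vertices with exactly $p$ cut edges; every connected graph $G$ on $n$ vertices with exactly $p$ cut edges satisfies $\rho(G)\le\rho(K_{n-p}(p))$; and such a $G$ attains the maximum of $\rho$ over this class if and only if $G\cong K_{n-p}(p)$. -/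

import Mathlib

/-- The Harary (reciprocal distance) matrix of `G`: the `(u, v)` entry is `1 / d(u, v)` for
`u ≠ v`, and the diagonal entries are `0`. -/
noncomputable def hararyMatrix {V : Type*} [DecidableEq V] (G : SimpleGraph V) : Matrix V V ℝ :=
  Matrix.of fun u v => if u = v then 0 else 1 / (G.dist u v : ℝ)

/-- The Harary spectral radius: the supremum of `|μ|` over the eigenvalues `μ` of the Harary
matrix. The matrix is real symmetric, so all of its complex eigenvalues are real and the real
spectrum suffices. The value is finite, the spectrum being a finite set. -/
noncomputable def hararySpectralRadius {V : Type*} [Fintype V] [DecidableEq V]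
    (G : SimpleGraph V) : ENNReal :=
  spectralRadius ℝ (hararyMatrix G)

/-- The set of cut edges of `G`: the edges of `G` whose deletion separates their ends. -/
def cutEdges {V : Type*} (G : SimpleGraph V) : Set (Sym2 V) :=
  {e | e ∈ G.edgeSet ∧ G.IsBridge e}

/-- `G` is a connected graph on `n` vertices with exactly `p` cut edges. -/
structure IsConnectedWithCutEdges {V : Type*} [Fintype V] (n p : ℕ) (G : SimpleGraph V) :
    Prop where
  connected : G.Connected
  card_eq : Fintype.card V = n
  ncard_cutEdges : (cutEdges G).ncard = p

/-- The graph `K_t(p)`: the complete graph on the vertices `inl a`, `a : Fin t`, together with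
`p` pendant vertices `inr b`, all of them attached to the vertex `inl 0`. It is intended for
`1 ≤ t`. -/
def completeWithPendants (t p : ℕ) : SimpleGraph (Fin t ⊕ Fin p) where
  Adj x y :=
    match x, y with
    | .inl a, .inl b => a ≠ b
    | .inl a, .inr _ => (a : ℕ) = 0
    | .inr _, .inl a => (a : ℕ) = 0
    | .inr _, .inr _ => False
  symm := ⟨by rintro (a | a) (b | b) h <;> first | exact h | exact Ne.symm h⟩
  loopless := ⟨by rintro (a | a) h <;> simp at h⟩

/-! Let `x` be a Perron vector of the Harary matrix of `G` and `c` a vertex where `x` is largest. An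
off-diagonal Harary entry is at most 1/2, plus another 1/2 for adjacent pairs, with equality in
`pendantClique c R`, whose diameter is at most 2. So it is enough to compare the sums of `x u * x v`
over adjacent pairs.

Take `R = farEnds G c`, which has one vertex per cut edge. The cut edges split `G` into components,
each with a single root: `c` or a far end. `shiftDart` moves to `c` the near end of a cut edge, and
the root end of an edge inside a component. This maps the adjacent pairs of `G` injectively to those
of the pendant clique (`shiftDart_injOn`), and no weight drops because `x` is largest at `c`.

If the radii agree, `x` is also an eigenvector for the pendant clique, where the entry at `c` beats
that of every vertex missing another one (`eigenvector_lt_base`). Hence no end really moves, and the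
graphs coincide. -/

open SimpleGraph Matrix

/-! ### Cut edges seen from a base vertex, and the components they leave. -/

section FarEnds

variable {V : Type*} {G : SimpleGraph V} {c : V}

/-- The edge `uv` of `G` is a cut edge and `v` is its end separated from `c`. -/
def IsFarEnd (G : SimpleGraph V) (c u v : V) : Prop :=
  G.Adj u v ∧ ¬ (G.deleteEdges {s(u, v)}).Reachable c v

/-- The ends of cut edges of `G` that their cut edge separates from `c`. -/
def farEnds (G : SimpleGraph V) (c : V) : Set V := {v | ∃ u, IsFarEnd G c u v}

theorem IsFarEnd.ne_base {u v : V} (h : IsFarEnd G c u v) : v ≠ c := by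
  rintro rfl
  exact h.2 (Reachable.refl _)

theorem base_notMem_farEnds : c ∉ farEnds G c := fun ⟨_, h⟩ => h.ne_base rfl

theorem reachable_deleteEdges_of_notMem_support {u v a b : V} (w : G.Walk a b)
    (h : v ∉ w.support) : (G.deleteEdges {s(u, v)}).Reachable a b := by
  refine ⟨w.toDeleteEdge _ fun he => h ?_⟩
  exact w.snd_mem_support_of_mem_edges he

/-- A walk from `c` that avoids `v` does not use the edge `uv`, so a shortest walk to anything on
the side of `v` passes through `v`. -/
theorem IsFarEnd.dist_lt {u v z : V} (hG : G.Connected) (h : IsFarEnd G c u v)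
    (hz : (G.deleteEdges {s(u, v)}).Reachable v z) (hne : z ≠ v) :
    G.dist c v < G.dist c z := by
  classical
  obtain ⟨w, hw⟩ := hG.exists_walk_length_eq_dist c z
  by_cases hv : v ∈ w.support
  · have h1 := dist_le (w.takeUntil v hv)
    have h2 : (w.takeUntil v hv).length < w.length :=
      w.length_takeUntil_lt_length hv (Ne.symm hne)
    omega
  · exact absurd ((reachable_deleteEdges_of_notMem_support w hv).trans hz.symm) h.2

theorem exists_adj_dist_lt (hG : G.Connected) {v : V} (hv : v ≠ c) :
    ∃ z, G.Adj z v ∧ G.dist c z < G.dist c v := by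
  obtain ⟨w, hw⟩ := hG.exists_walk_length_eq_dist c v
  have hn : ¬ w.Nil := w.not_nil_of_ne hv.symm
  refine ⟨w.penultimate, w.adj_penultimate hn, ?_⟩
  have h1 := dist_le w.dropLast
  have h2 : w.dropLast.length < w.length := by
    rw [Walk.length_dropLast]
    have := Walk.not_nil_iff_lt_length.1 hn
    omega
  omega

theorem IsFarEnd.eq_of_dist_lt {u v z : V} (hG : G.Connected) (h : IsFarEnd G c u v)
    (hz : G.Adj z v) (hd : G.dist c z < G.dist c v) : z = u := by
  by_contra hne
  refine (h.dist_lt hG (z := z) (Adj.reachable ?_) hz.ne).not_gt hd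
  rw [deleteEdges_adj]
  refine ⟨hz.symm, ?_⟩
  have := hz.ne
  simp only [Set.mem_singleton_iff, Sym2.eq_iff]
  grind

theorem IsFarEnd.dist_base_lt {u v : V} (hG : G.Connected) (h : IsFarEnd G c u v) :
    G.dist c u < G.dist c v := by
  obtain ⟨z, hz, hd⟩ := exists_adj_dist_lt hG h.ne_base
  rwa [← h.eq_of_dist_lt hG hz hd]

theorem IsFarEnd.left_unique {u u' v : V} (hG : G.Connected) (h : IsFarEnd G c u v)
    (h' : IsFarEnd G c u' v) : u = u' :=
  h'.eq_of_dist_lt hG h.1 (h.dist_base_lt hG)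

theorem IsFarEnd.not_symm {u v : V} (hG : G.Connected) (h : IsFarEnd G c u v) :
    ¬ IsFarEnd G c v u := fun h' => (h.dist_base_lt hG).not_gt (h'.dist_base_lt hG)

theorem mem_cutEdges_iff (hG : G.Connected) (c : V) {a b : V} :
    s(a, b) ∈ cutEdges G ↔ IsFarEnd G c a b ∨ IsFarEnd G c b a := by
  have key : ∀ {a b : V}, IsFarEnd G c a b → s(a, b) ∈ cutEdges G := fun {a b} h =>
    ⟨h.1, fun hr => (h.dist_lt hG hr.symm h.1.ne).not_gt (h.dist_base_lt hG)⟩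
  constructor
  · rintro ⟨hadj, hb⟩
    by_contra! hcon
    have h1 : (G.deleteEdges {s(a, b)}).Reachable c b := by
      by_contra h; exact hcon.1 ⟨hadj, h⟩
    have h2 : (G.deleteEdges {s(a, b)}).Reachable c a := by
      by_contra h; exact hcon.2 ⟨hadj.symm, by rwa [Sym2.eq_swap]⟩
    exact hb (h2.symm.trans h1)
  · rintro (h | h)
    · exact key h
    · rw [Sym2.eq_swap]; exact key h

/-- A cut edge separates exactly one of its ends from `c`, and that end determines the edge: its
near end is its only neighbour closer to `c`. -/
theorem ncard_farEnds (hG : G.Connected) (c : V) :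
    (farEnds G c).ncard = (cutEdges G).ncard := by
  choose! π hπ using fun v (h : v ∈ farEnds G c) => h
  refine Set.ncard_congr (fun v _ => s(π v, v)) (fun v hv => ?_) (fun v w hv hw h => ?_) ?_
  · exact (mem_cutEdges_iff hG c).2 (Or.inl (hπ v hv))
  · rcases Sym2.eq_iff.1 h with h | h
    · exact h.2
    · have h1 := hπ v hv
      have h2 := hπ w hw
      rw [h.1] at h1
      rw [← h.2] at h2
      exact absurd h2 (h1.not_symm hG)
  · intro e
    induction e using Sym2.ind with
    | _ a b =>
      intro he
      rcases (mem_cutEdges_iff hG c).1 he with h | h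
      · exact ⟨b, ⟨a, h⟩, by rw [(hπ b ⟨a, h⟩).left_unique hG h]⟩
      · exact ⟨a, ⟨b, h⟩, by rw [(hπ a ⟨b, h⟩).left_unique hG h, Sym2.eq_swap]⟩

/-- Adjacency in `G` along an edge that is not a cut edge. -/
def IsCycleAdj (G : SimpleGraph V) (c u v : V) : Prop :=
  G.Adj u v ∧ ¬ IsFarEnd G c u v ∧ ¬ IsFarEnd G c v u

theorem IsCycleAdj.symm {u v : V} (h : IsCycleAdj G c u v) : IsCycleAdj G c v u :=
  ⟨h.1.symm, h.2.2, h.2.1⟩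

theorem IsCycleAdj.reachable_deleteEdges {u v a b : V} (h : IsCycleAdj G c u v)
    (hab : IsFarEnd G c a b) : (G.deleteEdges {s(a, b)}).Reachable u v := by
  refine Adj.reachable (deleteEdges_adj.2 ⟨h.1, ?_⟩)
  simp only [Set.mem_singleton_iff, Sym2.eq_iff]
  rintro (⟨rfl, rfl⟩ | ⟨rfl, rfl⟩)
  · exact h.2.1 hab
  · exact h.2.2 hab

/-- Two roots of components left by the cut edges coincide if no cut edge separates them. -/
theorem eq_of_forall_reachable_deleteEdges (hG : G.Connected) {s t : V}
    (hs : s = c ∨ s ∈ farEnds G c) (ht : t = c ∨ t ∈ farEnds G c)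
    (h : ∀ a b, IsFarEnd G c a b → (G.deleteEdges {s(a, b)}).Reachable s t) : s = t := by
  by_contra hne
  rcases hs with rfl | ⟨a, ha⟩ <;> rcases ht with rfl | ⟨b, hb⟩
  · exact hne rfl
  · exact hb.2 (h _ _ hb)
  · exact ha.2 (h _ _ ha).symm
  -- Each of the two roots would be strictly closer to `c` than the other.
  · exact (ha.dist_lt hG (h _ _ ha) (Ne.symm hne)).not_gt
      (hb.dist_lt hG (h _ _ hb).symm hne)

/-- An end of an edge that is to be moved to `c`: either the near end of a cut edge, or the root
of a component when the edge lies in that component. -/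
def IsMovable (G : SimpleGraph V) (c u v : V) : Prop :=
  IsFarEnd G c u v ∨ IsCycleAdj G c u v ∧ (u = c ∨ u ∈ farEnds G c)

theorem IsCycleAdj.not_root (hG : G.Connected) {u v : V} (h : IsCycleAdj G c u v)
    (hu : u = c ∨ u ∈ farEnds G c) : ¬ (v = c ∨ v ∈ farEnds G c) := fun hv =>
  h.1.ne (eq_of_forall_reachable_deleteEdges hG hu hv fun _ _ hab =>
    h.reachable_deleteEdges hab)

theorem IsMovable.adj {u v : V} (h : IsMovable G c u v) : G.Adj u v :=
  h.elim (fun h => h.1) fun h => h.1.1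

theorem IsMovable.ne_base (hG : G.Connected) {u v : V} (h : IsMovable G c u v) : v ≠ c := by
  rcases h with h | ⟨h, hu⟩
  · exact h.ne_base
  · exact fun hv => h.not_root hG hu (Or.inl hv)

theorem IsMovable.not_symm (hG : G.Connected) {u v : V} (h : IsMovable G c u v) :
    ¬ IsMovable G c v u := by
  rcases h with h | ⟨h, hu⟩
  · rintro (h' | ⟨h', -⟩)
    · exact h.not_symm hG h'
    · exact h'.2.2 h
  · rintro (h' | ⟨-, hv⟩)
    · exact h.2.2 h'
    · exact h.not_root hG hu hv

theorem IsMovable.left_unique (hG : G.Connected) {u u' v : V} (h : IsMovable G c u v)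
    (h' : IsMovable G c u' v) : u = u' := by
  rcases h with h | ⟨h, hu⟩ <;> rcases h' with h' | ⟨h', hu'⟩
  · exact h.left_unique hG h'
  · exact absurd (Or.inr ⟨u, h⟩) (h'.not_root hG hu')
  · exact absurd (Or.inr ⟨u', h'⟩) (h.not_root hG hu)
  · exact eq_of_forall_reachable_deleteEdges hG hu hu' fun _ _ hab =>
      (h.reachable_deleteEdges hab).trans (h'.reachable_deleteEdges hab).symm

theorem notMem_of_not_isMovable {u v : V} (h : G.Adj u v) (h1 : ¬ IsMovable G c u v)
    (h2 : ¬ IsMovable G c v u) :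
    (u ≠ c ∧ u ∉ farEnds G c) ∧ (v ≠ c ∧ v ∉ farEnds G c) := by
  have hc : IsCycleAdj G c u v := ⟨h, fun h => h1 (Or.inl h), fun h => h2 (Or.inl h)⟩
  have h1 : ¬ (u = c ∨ u ∈ farEnds G c) := fun hu => h1 (Or.inr ⟨hc, hu⟩)
  have h2 : ¬ (v = c ∨ v ∈ farEnds G c) := fun hu => h2 (Or.inr ⟨hc.symm, hu⟩)
  tauto

/-- A vertex that is not a root of its component has two neighbours in the component. -/
theorem exists_isCycleAdj_ne (hG : G.Connected) {w : V} (hw : w ∉ farEnds G c) (hc : w ≠ c) :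
    ∃ z z', z ≠ z' ∧ IsCycleAdj G c z w ∧ IsCycleAdj G c z' w := by
  classical
  have hnot : ∀ z, ¬ IsFarEnd G c z w := fun z h => hw ⟨z, h⟩
  obtain ⟨z, hz, hd⟩ := exists_adj_dist_lt hG hc
  refine ⟨z, ?_⟩
  -- The edge `zw` does not separate `w` from `c`; the last edge of a path avoiding it supplies the
  -- second neighbour.
  have hr : (G.deleteEdges {s(z, w)}).Reachable c w := by
    by_contra h
    exact hnot z ⟨hz, h⟩
  obtain ⟨p, hp⟩ := hr.exists_isPath
  have hn : ¬ p.Nil := p.not_nil_of_ne hc.symm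
  have hadj := p.adj_penultimate hn
  rw [deleteEdges_adj] at hadj
  refine ⟨p.penultimate, ?_, ⟨hz, hnot z, fun h => (h.dist_base_lt hG).not_gt hd⟩,
    hadj.1, hnot _, fun h => h.2 ?_⟩
  · intro h
    exact hadj.2 (by simp [← h])
  · have hs : w ∉ p.dropLast.support := by
      have := hp.support_nodup
      rw [← p.concat_dropLast (p.adj_penultimate hn), Walk.support_concat,
        List.nodup_append] at this
      exact fun hs => this.2.2 _ hs _ (by simp) rfl
    have := reachable_deleteEdges_of_notMem_support (u := p.penultimate)
      (p.dropLast.mapLe (deleteEdges_le _)) (by simpa using hs)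
    rwa [Sym2.eq_swap]

/-- A lone non-root vertex would have two distinct neighbours in its component, both of them roots.
The case has to be excluded because a clique on two vertices is itself a cut edge. -/
theorem ncard_compl_farEnds_ne_two (hG : G.Connected) (c : V) :
    (farEnds G c)ᶜ.ncard ≠ 2 := by
  intro h
  obtain ⟨w, hw, hS⟩ : ∃ w, w ≠ c ∧ (farEnds G c)ᶜ = {c, w} := by
    obtain ⟨a, b, hab, hS⟩ := Set.ncard_eq_two.1 h
    have hc : c ∈ (farEnds G c)ᶜ := base_notMem_farEnds
    rw [hS] at hc
    rcases hc with rfl | rfl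
    · exact ⟨b, hab.symm, hS⟩
    · exact ⟨a, hab, by rw [hS, Set.pair_comm]⟩
  have hwR : w ∈ (farEnds G c)ᶜ := by simp [hS]
  obtain ⟨z, z', hne, hz, hz'⟩ := exists_isCycleAdj_ne hG hwR hw
  have key : ∀ y, IsCycleAdj G c y w → y = c ∨ y ∈ farEnds G c := by
    intro y hy
    by_contra! hcon
    have hyS : y ∈ (farEnds G c)ᶜ := hcon.2
    rw [hS] at hyS
    rcases hyS with h | h
    · exact hcon.1 h
    · exact hy.1.ne h
  exact hne (eq_of_forall_reachable_deleteEdges hG (key z hz) (key z' hz') fun _ _ hab =>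
    (hz.reachable_deleteEdges hab).trans (hz'.reachable_deleteEdges hab).symm)

end FarEnds

/-! ### Rayleigh quotients of real symmetric matrices. -/

section Spectral

variable {ι : Type*} [Fintype ι] [DecidableEq ι]

/-- The spectral radius of a real symmetric matrix is the absolute value of a Rayleigh quotient
and bounds all Rayleigh quotients; it is attained only at eigenvectors. -/
theorem Matrix.IsHermitian.exists_spectralRadius_eq [Nonempty ι] {M : Matrix ι ι ℝ}
    (hM : M.IsHermitian) :
    ∃ r : ℝ, 0 ≤ r ∧ spectralRadius ℝ M = ENNReal.ofReal r ∧
      (∃ v : ι → ℝ, v ≠ 0 ∧ |v ⬝ᵥ (M *ᵥ v)| = r * (v ⬝ᵥ v)) ∧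
      ∀ y : ι → ℝ, y ⬝ᵥ (M *ᵥ y) ≤ r * (y ⬝ᵥ y) ∧
        (y ⬝ᵥ (M *ᵥ y) = r * (y ⬝ᵥ y) → M *ᵥ y = r • y) := by
  obtain ⟨i, -, hi⟩ := Finset.exists_max_image Finset.univ (fun i => |hM.eigenvalues i|)
    Finset.univ_nonempty
  refine ⟨|hM.eigenvalues i|, abs_nonneg _, ?_, ⟨hM.eigenvectorBasis i, ?_, ?_⟩, fun y => ?_⟩
  · rw [spectralRadius, hM.spectrum_real_eq_range_eigenvalues]
    simp only [iSup_range]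
    have h : ∀ a : ℝ, (‖a‖₊ : ENNReal) = ENNReal.ofReal |a| := fun a => by
      rw [← Real.norm_eq_abs, ofReal_norm, enorm_eq_nnnorm]
    simp only [h]
    refine le_antisymm (iSup_le fun j => ENNReal.ofReal_le_ofReal (hi j (Finset.mem_univ _))) ?_
    exact le_iSup (fun j => ENNReal.ofReal |hM.eigenvalues j|) i
  · intro h
    refine hM.eigenvectorBasis.orthonormal.ne_zero i ?_
    ext j
    exact congrFun h j
  · rw [hM.mulVec_eigenvectorBasis i, dotProduct_smul, smul_eq_mul, abs_mul]
    congr 1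
    exact abs_of_nonneg (Finset.sum_nonneg fun _ _ => mul_self_nonneg _)
  · set r := |hM.eigenvalues i|
    -- Nonnegativity of this form is the Rayleigh bound; its zeros lie in the kernel, which is the
    -- equality case.
    have hpsd : (r • (1 : Matrix ι ι ℝ) - M).PosSemidef := by
      rw [posSemidef_iff_isHermitian_and_spectrum_nonneg]
      refine ⟨?_, ?_⟩
      · exact (isHermitian_one.smul (IsSelfAdjoint.all r)).sub hM
      · rw [← Algebra.algebraMap_eq_smul_one, ← spectrum.singleton_sub_eq,
          hM.spectrum_real_eq_range_eigenvalues]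
        rintro _ ⟨_, rfl, _, ⟨j, rfl⟩, rfl⟩
        exact sub_nonneg.2 ((le_abs_self _).trans (hi j (Finset.mem_univ _)))
    have hq : y ⬝ᵥ ((r • (1 : Matrix ι ι ℝ) - M) *ᵥ y) = r * (y ⬝ᵥ y) - y ⬝ᵥ (M *ᵥ y) := by
      rw [sub_mulVec, dotProduct_sub, smul_mulVec, one_mulVec, dotProduct_smul, smul_eq_mul]
    refine ⟨?_, fun h => ?_⟩
    · have := hpsd.dotProduct_mulVec_nonneg y
      rw [star_trivial, hq] at this
      linarith
    · have := (hpsd.dotProduct_mulVec_zero_iff y).1 (by rw [star_trivial, hq, h, sub_self])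
      rw [sub_mulVec, smul_mulVec, one_mulVec] at this
      exact (sub_eq_zero.1 this).symm

end Spectral

/-! ### Perron vectors of the Harary matrix. -/

section Harary

variable {V : Type*} [DecidableEq V] {G : SimpleGraph V}

theorem hararyMatrix_apply_nonneg (u v : V) : 0 ≤ hararyMatrix G u v := by
  simp only [hararyMatrix, of_apply]
  split_ifs <;> positivity

theorem hararyMatrix_apply_pos (hG : G.Connected) {u v : V} (h : u ≠ v) :
    0 < hararyMatrix G u v := by
  have := hG.pos_dist_of_ne h
  simp only [hararyMatrix, of_apply, if_neg h]
  positivity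

theorem hararyMatrix_isHermitian : (hararyMatrix G).IsHermitian := by
  ext u v
  simp [hararyMatrix, dist_comm, eq_comm]

variable [Fintype V]

omit [DecidableEq V] in
theorem dotProduct_mulVec_eq_sum (M : Matrix V V ℝ) (x : V → ℝ) :
    x ⬝ᵥ (M *ᵥ x) = ∑ u, ∑ v, M u v * (x u * x v) := by
  simp only [dotProduct, mulVec, Finset.mul_sum]
  exact Finset.sum_congr rfl fun u _ => Finset.sum_congr rfl fun v _ => by ring

/-- A positive Perron vector of the Harary matrix, with the variational description of the
spectral radius. -/
theorem exists_harary_perron (hG : G.Connected) :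
    ∃ r : ℝ, 0 ≤ r ∧ hararySpectralRadius G = ENNReal.ofReal r ∧
      (∃ x : V → ℝ, (∀ v, 0 < x v) ∧ x ⬝ᵥ (hararyMatrix G *ᵥ x) = r * (x ⬝ᵥ x)) ∧
      ∀ y : V → ℝ, y ⬝ᵥ (hararyMatrix G *ᵥ y) ≤ r * (y ⬝ᵥ y) ∧
        (y ⬝ᵥ (hararyMatrix G *ᵥ y) = r * (y ⬝ᵥ y) → hararyMatrix G *ᵥ y = r • y) := by
  have := hG.nonempty
  obtain ⟨r, hr, hrad, ⟨v, hv, hvr⟩, hmax⟩ :=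
    (hararyMatrix_isHermitian (G := G)).exists_spectralRadius_eq
  refine ⟨r, hr, hrad, ⟨fun i => |v i|, ?_⟩, hmax⟩
  set x : V → ℝ := fun i => |v i|
  have hxx : x ⬝ᵥ x = v ⬝ᵥ v := by simp [dotProduct, x]
  have hle : |v ⬝ᵥ (hararyMatrix G *ᵥ v)| ≤ x ⬝ᵥ (hararyMatrix G *ᵥ x) := by
    rw [dotProduct_mulVec_eq_sum, dotProduct_mulVec_eq_sum]
    refine (Finset.abs_sum_le_sum_abs _ _).trans (Finset.sum_le_sum fun i _ => ?_)
    refine (Finset.abs_sum_le_sum_abs _ _).trans (Finset.sum_le_sum fun j _ => ?_)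
    rw [abs_mul, abs_mul, abs_of_nonneg (hararyMatrix_apply_nonneg i j)]
  have hx : x ⬝ᵥ (hararyMatrix G *ᵥ x) = r * (x ⬝ᵥ x) :=
    le_antisymm (hmax x).1 (by rwa [hxx, ← hvr])
  -- If one entry vanished, its row of the eigenvector equation, positive off the diagonal, would
  -- make all entries vanish.
  refine ⟨fun i => (abs_nonneg _).lt_of_ne' fun hi => hv ?_, hx⟩
  have hrow := congrFun ((hmax x).2 hx) i
  simp only [mulVec, dotProduct, Pi.smul_apply, smul_eq_mul] at hrow
  rw [show x i = 0 from hi, mul_zero, Finset.sum_eq_zero_iff_of_nonneg fun j _ =>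
    mul_nonneg (hararyMatrix_apply_nonneg i j) (abs_nonneg _)] at hrow
  ext j
  by_cases hij : i = j
  · subst hij
    exact abs_eq_zero.1 hi
  · have h := hrow j (Finset.mem_univ _)
    exact abs_eq_zero.1 ((mul_eq_zero.1 h).resolve_left (hararyMatrix_apply_pos hG hij).ne')

end Harary

/-! ### Invariance under isomorphism. -/

section Iso

variable {V W : Type*} {G : SimpleGraph V} {H : SimpleGraph W}

theorem SimpleGraph.Iso.dist_le (f : G ≃g H) (hG : G.Connected) (u v : V) :
    H.dist (f u) (f v) ≤ G.dist u v := by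
  obtain ⟨w, hw⟩ := hG.exists_walk_length_eq_dist u v
  rw [← hw, ← Walk.length_map f.toHom w]
  exact SimpleGraph.dist_le _

theorem SimpleGraph.Iso.dist_eq (f : G ≃g H) (hG : G.Connected) (u v : V) :
    H.dist (f u) (f v) = G.dist u v := by
  refine (f.dist_le hG u v).antisymm ?_
  simpa using f.symm.dist_le (f.connected_iff.1 hG) (f u) (f v)

theorem hararySpectralRadius_eq_of_iso [Fintype V] [DecidableEq V] [Fintype W] [DecidableEq W]
    (f : G ≃g H) (hG : G.Connected) : hararySpectralRadius G = hararySpectralRadius H := by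
  have h : hararyMatrix H = reindexAlgEquiv ℝ ℝ f.toEquiv (hararyMatrix G) := by
    ext a b
    obtain ⟨u, rfl⟩ := f.surjective a
    obtain ⟨v, rfl⟩ := f.surjective b
    have hu : ∀ u, f.toEquiv.symm (f u) = u := fun u => f.symm_apply_apply u
    simp [hararyMatrix, f.dist_eq hG, hu]
  rw [hararySpectralRadius, hararySpectralRadius, spectralRadius, spectralRadius, h,
    AlgEquiv.spectrum_eq]

theorem SimpleGraph.Iso.isBridge_map (f : G ≃g H) {a b : V} (h : H.IsBridge s(f a, f b)) :
    G.IsBridge s(a, b) := by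
  rw [isBridge_iff] at *
  refine fun hr => h (hr.map ⟨f, fun {x y} hxy => ?_⟩)
  rw [deleteEdges_adj] at *
  refine ⟨f.map_adj_iff.2 hxy.1, fun hs => hxy.2 ?_⟩
  simpa using hs

theorem ncard_cutEdges_eq_of_iso (f : G ≃g H) : (cutEdges G).ncard = (cutEdges H).ncard := by
  refine Set.ncard_congr (fun e _ => Sym2.map f e) ?_ ?_ ?_
  · intro e
    induction e using Sym2.ind with
    | _ a b =>
      intro h
      exact ⟨f.map_adj_iff.2 h.1, f.symm.isBridge_map (by simpa using h.2)⟩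
  · exact fun e e' _ _ h => Sym2.map.injective f.injective h
  · intro e
    induction e using Sym2.ind with
    | _ a b =>
      intro h
      obtain ⟨u, rfl⟩ := f.surjective a
      obtain ⟨v, rfl⟩ := f.surjective b
      exact ⟨s(u, v), ⟨f.map_adj_iff.1 h.1, f.isBridge_map h.2⟩, rfl⟩

theorem IsConnectedWithCutEdges.of_iso [Fintype V] [Fintype W] {n p : ℕ} (f : G ≃g H)
    (h : IsConnectedWithCutEdges n p G) : IsConnectedWithCutEdges n p H :=
  ⟨f.connected_iff.1 h.connected, by rw [← h.card_eq, Fintype.card_congr f.toEquiv],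
    by rw [← h.ncard_cutEdges, ncard_cutEdges_eq_of_iso f]⟩

end Iso

/-! ### The extremal graph on a given vertex set. -/

section PendantClique

variable {V : Type*} {c : V} {R : Set V}

/-- The complete graph on the complement of `R`, with the vertices of `R` attached to `c` as
pendant vertices. -/
def pendantClique (c : V) (R : Set V) : SimpleGraph V where
  Adj a b := a ≠ b ∧ (a = c ∨ b = c ∨ a ∉ R ∧ b ∉ R)
  symm := ⟨fun a b h => ⟨h.1.symm, by tauto⟩⟩
  loopless := ⟨fun _ h => h.1 rfl⟩

theorem pendantClique_adj {a b : V} :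
    (pendantClique c R).Adj a b ↔ a ≠ b ∧ (a = c ∨ b = c ∨ a ∉ R ∧ b ∉ R) := Iff.rfl

theorem pendantClique_base_adj {v : V} (h : v ≠ c) : (pendantClique c R).Adj c v :=
  ⟨h.symm, Or.inl rfl⟩

theorem pendantClique_connected : (pendantClique c R).Connected := by
  refine connected_iff_exists_forall_reachable _ |>.2 ⟨c, fun v => ?_⟩
  by_cases h : v = c
  · rw [h]
  · exact (pendantClique_base_adj h).reachable

theorem pendantClique_dist_of_not_adj {u v : V} (h : u ≠ v) (ha : ¬ (pendantClique c R).Adj u v) :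
    (pendantClique c R).dist u v = 2 := by
  have hu : u ≠ c := fun h' => ha ⟨h, Or.inl h'⟩
  have hv : v ≠ c := fun h' => ha ⟨h, Or.inr (Or.inl h')⟩
  have h1 := pendantClique_connected.one_lt_dist_of_ne_of_not_adj h ha
  have h2 := dist_le (Walk.cons (pendantClique_base_adj (R := R) hu).symm
    (pendantClique_base_adj (R := R) hv).toWalk)
  simp only [Walk.length_cons, Adj.toWalk, Walk.length_nil] at h2
  omega

theorem farEnds_pendantClique [Finite V] (hc : c ∉ R) (h2 : Rᶜ.ncard ≠ 2) :
    farEnds (pendantClique c R) c = R := by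
  ext v
  constructor
  · rintro ⟨u, h⟩
    by_contra hv
    have hvc := h.ne_base
    -- A third clique vertex gives the detour `c`, `d`, `v` around the edge `cv`.
    obtain ⟨d, hd, hdc, hdv⟩ : ∃ d, d ∉ R ∧ d ≠ c ∧ d ≠ v := by
      by_contra! hcon
      refine h2 ?_
      rw [← Set.ncard_pair hvc.symm]
      congr 1
      ext d
      simp only [Set.mem_compl_iff, Set.mem_insert_iff, Set.mem_singleton_iff]
      refine ⟨fun hd => or_iff_not_imp_left.2 (hcon d hd), ?_⟩
      rintro (rfl | rfl) <;> assumption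
    refine h.2 ?_
    by_cases huc : u = c
    · subst huc
      have h1 : ((pendantClique u R).deleteEdges {s(u, v)}).Adj u d := by
        rw [deleteEdges_adj]
        refine ⟨pendantClique_base_adj hdc, ?_⟩
        simp only [Set.mem_singleton_iff, Sym2.eq_iff]
        grind
      have h3 : ((pendantClique u R).deleteEdges {s(u, v)}).Adj d v := by
        rw [deleteEdges_adj]
        refine ⟨⟨hdv, Or.inr (Or.inr ⟨hd, hv⟩)⟩, ?_⟩
        simp only [Set.mem_singleton_iff, Sym2.eq_iff]
        grind
      exact h1.reachable.trans h3.reachable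
    · refine Adj.reachable (deleteEdges_adj.2 ⟨pendantClique_base_adj hvc, ?_⟩)
      simp only [Set.mem_singleton_iff, Sym2.eq_iff]
      grind
  · intro hv
    have hvc : v ≠ c := by rintro rfl; exact hc hv
    refine ⟨c, pendantClique_base_adj hvc, ?_⟩
    rintro ⟨w⟩
    have hadj := w.adj_penultimate (w.not_nil_of_ne hvc.symm)
    rw [deleteEdges_adj, pendantClique_adj] at hadj
    obtain ⟨⟨-, h | h | h⟩, hs⟩ := hadj
    · exact hs (by simp [h])
    · exact hvc h
    · exact h.2 hv

theorem isConnectedWithCutEdges_pendantClique [Fintype V] (hc : c ∉ R) (h2 : Rᶜ.ncard ≠ 2) :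
    IsConnectedWithCutEdges (Fintype.card V) R.ncard (pendantClique c R) :=
  ⟨pendantClique_connected, rfl, by
    rw [← ncard_farEnds pendantClique_connected c, farEnds_pendantClique hc h2]⟩

theorem nonempty_iso_completeWithPendants [Fintype V] {n p : ℕ} (hc : c ∉ R)
    (hn : Fintype.card V = n) (hp : R.ncard = p) :
    Nonempty (pendantClique c R ≃g completeWithPendants (n - p) p) := by
  classical
  have hcard : Nat.card ↥Rᶜ = n - p := by
    rw [Nat.card_coe_set_eq, Set.ncard_compl, Nat.card_eq_fintype_card, hn, hp]
  let e₀ : ↥Rᶜ ≃ Fin (n - p) := Finite.equivFinOfCardEq hcard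
  let e₂ : ↥R ≃ Fin p := Finite.equivFinOfCardEq (by rw [Nat.card_coe_set_eq, hp])
  let c' : ↥Rᶜ := ⟨c, hc⟩
  have h0 : 0 < n - p := (Nat.zero_le _).trans_lt (e₀ c').isLt
  -- The swap sends `c` to 0, where the pendants are attached.
  let e₁ : ↥Rᶜ ≃ Fin (n - p) := e₀.trans (Equiv.swap (e₀ c') ⟨0, h0⟩)
  have he₁ : e₁ c' = ⟨0, h0⟩ := by simp [e₁]
  let E : Fin (n - p) ⊕ Fin p ≃ V :=
    ((Equiv.sumComm _ _).trans (Equiv.sumCongr e₂.symm e₁.symm)).trans (Equiv.Set.sumCompl R)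
  have hl : ∀ a, E (.inl a) = e₁.symm a := fun a => by simp [E]
  have hr : ∀ b, E (.inr b) = e₂.symm b := fun a => by simp [E]
  have hlR : ∀ a, E (.inl a) ∉ R := fun a => by rw [hl]; exact (e₁.symm a).2
  have hrR : ∀ b, E (.inr b) ∈ R := fun a => by rw [hr]; exact (e₂.symm a).2
  have hrc : ∀ b, E (.inr b) ≠ c := fun b h => hc (h ▸ hrR b)
  have hlc : ∀ a, E (.inl a) = c ↔ (a : ℕ) = 0 := fun a => by
    rw [hl, ← show (c' : V) = c from rfl, Subtype.coe_inj, Equiv.symm_apply_eq, he₁, Fin.ext_iff]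
  refine ⟨RelIso.symm ⟨E, ?_⟩⟩
  rintro (a | a) (b | b)
  · simp [pendantClique_adj, completeWithPendants, hlR]
  · simp [pendantClique_adj, completeWithPendants, hlR, hrR, hrc, hlc]
  · simp [pendantClique_adj, completeWithPendants, hlR, hrR, hrc, hlc]
  · simp [pendantClique_adj, completeWithPendants, hrR, hrc]

end PendantClique

/-! ### Shifting edges to the base vertex, and the comparison of radii. -/

section Comparison

variable {V : Type*} {G : SimpleGraph V} {c : V}

open Classical in
/-- Moves the movable end of a dart to `c`. -/
noncomputable def shiftDart (G : SimpleGraph V) (c : V) (d : V × V) : V × V :=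
  if IsMovable G c d.1 d.2 then (c, d.2) else if IsMovable G c d.2 d.1 then (d.1, c) else d

/-- A moved dart has `c` at exactly one end, and its other end determines the end that was moved
(`IsMovable.left_unique`). An unmoved dart avoids `c`. -/
theorem shiftDart_injOn (hG : G.Connected) :
    Set.InjOn (shiftDart G c) {d | G.Adj d.1 d.2} := by
  rintro ⟨u, v⟩ huv ⟨u', v'⟩ huv' h
  simp only [Set.mem_ofPred_eq] at huv huv'
  have hl := fun a b (h : IsMovable G c a b) => h.ne_base hG
  have hu := fun a a' b (h : IsMovable G c a b) (h' : IsMovable G c a' b) => h.left_unique hG h'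
  have hn := fun h1 h2 => notMem_of_not_isMovable (c := c) huv h1 h2
  have hn' := fun h1 h2 => notMem_of_not_isMovable (c := c) huv' h1 h2
  simp only [shiftDart] at h
  split_ifs at h <;> simp only [Prod.mk.injEq] at h ⊢ <;> grind

theorem pendantClique_adj_shiftDart (hG : G.Connected) {d : V × V} (hd : G.Adj d.1 d.2) :
    (pendantClique c (farEnds G c)).Adj (shiftDart G c d).1 (shiftDart G c d).2 := by
  unfold shiftDart
  split_ifs with h1 h2
  · exact pendantClique_base_adj (h1.ne_base hG)
  · exact (pendantClique_base_adj (h2.ne_base hG)).symm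
  · have := notMem_of_not_isMovable hd h1 h2
    exact ⟨hd.ne, Or.inr (Or.inr ⟨this.1.2, this.2.2⟩)⟩

/-- An end that is actually moved was not adjacent to the other end in the clique with pendant
vertices. -/
theorem IsMovable.not_pendantClique_adj (hG : G.Connected) {u v : V} (h : IsMovable G c u v)
    (hu : u ≠ c) : ¬ (pendantClique c (farEnds G c)).Adj u v := by
  rintro ⟨-, h1 | h1 | h1⟩
  · exact hu h1
  · exact h.ne_base hG h1
  · rcases h with h | ⟨-, h⟩
    · exact h1.2 ⟨u, h⟩
    · exact h.elim hu h1.1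

variable {x : V → ℝ}

theorem weight_le_shiftDart (hx : ∀ v, 0 < x v) (hc : ∀ v, x v ≤ x c) (d : V × V) :
    x d.1 * x d.2 ≤ x (shiftDart G c d).1 * x (shiftDart G c d).2 := by
  unfold shiftDart
  split_ifs
  · exact mul_le_mul_of_nonneg_right (hc _) (hx _).le
  · exact mul_le_mul_of_nonneg_left (hc _) (hx _).le
  · exact le_rfl

variable [Fintype V]

open Classical in
/-- The ordered pairs of adjacent vertices. -/
noncomputable def adjPairs (G : SimpleGraph V) : Finset (V × V) :=
  Finset.univ.filter fun d => G.Adj d.1 d.2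

theorem mem_adjPairs {d : V × V} : d ∈ adjPairs G ↔ G.Adj d.1 d.2 := by
  simp [adjPairs]

open Classical in
theorem sum_shiftDart_le (hG : G.Connected) (hx : ∀ v, 0 < x v) :
    ∑ d ∈ adjPairs G, x (shiftDart G c d).1 * x (shiftDart G c d).2 ≤
      ∑ d ∈ adjPairs (pendantClique c (farEnds G c)), x d.1 * x d.2 := by
  have hinj : Set.InjOn (shiftDart G c) (adjPairs G : Set (V × V)) :=
    (shiftDart_injOn hG).mono fun d hd => mem_adjPairs.1 hd
  rw [← Finset.sum_image (f := fun d : V × V => x d.1 * x d.2) hinj]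
  refine Finset.sum_le_sum_of_subset_of_nonneg ?_ fun d _ _ => (mul_pos (hx _) (hx _)).le
  intro e he
  obtain ⟨d, hd, rfl⟩ := Finset.mem_image.1 he
  exact mem_adjPairs.2 (pendantClique_adj_shiftDart hG (mem_adjPairs.1 hd))

theorem sum_adjPairs_le (hG : G.Connected) (hx : ∀ v, 0 < x v) (hc : ∀ v, x v ≤ x c) :
    ∑ d ∈ adjPairs G, x d.1 * x d.2 ≤
      ∑ d ∈ adjPairs (pendantClique c (farEnds G c)), x d.1 * x d.2 :=
  (Finset.sum_le_sum fun d _ => weight_le_shiftDart hx hc d).trans (sum_shiftDart_le hG hx)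

/-- A genuine move would strictly increase a weight by `hlt`. So the shift is the identity, `G` is a
subgraph, and any further edge would add positive weight. -/
theorem eq_pendantClique_of_sum_eq (hG : G.Connected) (hx : ∀ v, 0 < x v)
    (hc : ∀ v, x v ≤ x c)
    (hlt : ∀ u v, u ≠ v → ¬ (pendantClique c (farEnds G c)).Adj u v → x u < x c)
    (h : ∑ d ∈ adjPairs G, x d.1 * x d.2 =
      ∑ d ∈ adjPairs (pendantClique c (farEnds G c)), x d.1 * x d.2) :
    G = pendantClique c (farEnds G c) := by
  have hmove : ∀ u v, IsMovable G c u v → u = c := by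
    intro u v hm
    by_contra hu
    refine ((sum_shiftDart_le (c := c) hG hx).trans_eq h.symm).not_gt
      (Finset.sum_lt_sum (fun d _ => weight_le_shiftDart hx hc d)
        ⟨(u, v), mem_adjPairs.2 hm.adj, ?_⟩)
    simp only [shiftDart, if_pos hm]
    exact mul_lt_mul_of_pos_right (hlt u v hm.adj.ne
      (hm.not_pendantClique_adj hG hu)) (hx v)
  have hid : ∀ d, shiftDart G c d = d := by
    intro d
    unfold shiftDart
    split_ifs with h1 h2
    · rw [← hmove _ _ h1]
    · rw [← hmove _ _ h2]
    · rfl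
  have hsub : adjPairs G ⊆ adjPairs (pendantClique c (farEnds G c)) := fun d hd => by
    have := pendantClique_adj_shiftDart (c := c) hG (mem_adjPairs.1 hd)
    rw [hid] at this
    exact mem_adjPairs.2 this
  have heq : adjPairs G = adjPairs (pendantClique c (farEnds G c)) := by
    by_contra hne
    obtain ⟨d, hd, hd'⟩ := Finset.exists_of_ssubset (hsub.ssubset_of_ne hne)
    exact (Finset.sum_lt_sum_of_subset hsub hd hd' (mul_pos (hx _) (hx _))
      fun _ _ _ => (mul_pos (hx _) (hx _)).le).ne h
  ext u v
  rw [← mem_adjPairs (d := (u, v)), heq, mem_adjPairs]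

variable [DecidableEq V]

omit [Fintype V] in
open Classical in
theorem hararyMatrix_apply_le (hG : G.Connected) (u v : V) :
    hararyMatrix G u v ≤ (if u = v then 0 else 1 / 2) + (if G.Adj u v then 1 / 2 else 0) := by
  simp only [hararyMatrix, of_apply]
  by_cases h : u = v
  · simp [h]
  by_cases ha : G.Adj u v
  · rw [dist_eq_one_iff_adj.2 ha]
    norm_num [h, ha]
  · have hd : (2 : ℝ) ≤ G.dist u v := by
      exact_mod_cast hG.one_lt_dist_of_ne_of_not_adj h ha
    simp only [h, ha, if_false, add_zero]
    exact one_div_le_one_div_of_le two_pos hd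

omit [Fintype V] in
open Classical in
theorem hararyMatrix_pendantClique_apply (c : V) (R : Set V) (u v : V) :
    hararyMatrix (pendantClique c R) u v =
      (if u = v then 0 else 1 / 2) + (if (pendantClique c R).Adj u v then 1 / 2 else 0) := by
  simp only [hararyMatrix, of_apply]
  by_cases h : u = v
  · simp [h]
  by_cases ha : (pendantClique c R).Adj u v
  · rw [dist_eq_one_iff_adj.2 ha]
    norm_num [h, ha]
  · rw [pendantClique_dist_of_not_adj h ha]
    simp [h, ha]

open Classical in
theorem sum_weight_eq (x : V → ℝ) :
    ∑ u, ∑ v, ((if u = v then 0 else 1 / 2) + (if G.Adj u v then 1 / 2 else 0)) * (x u * x v) =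
      (∑ u, ∑ v, (if u = v then 0 else 1 / 2) * (x u * x v)) +
        1 / 2 * ∑ d ∈ adjPairs G, x d.1 * x d.2 := by
  simp only [add_mul, Finset.sum_add_distrib, adjPairs, Finset.sum_filter, Fintype.sum_prod_type,
    Finset.mul_sum]
  congr 1
  refine Finset.sum_congr rfl fun u _ => Finset.sum_congr rfl fun v _ => ?_
  split_ifs <;> simp

theorem rayleigh_le (hG : G.Connected) (hx : ∀ v, 0 < x v) :
    x ⬝ᵥ (hararyMatrix G *ᵥ x) ≤ (∑ u, ∑ v, (if u = v then 0 else 1 / 2) * (x u * x v)) +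
        1 / 2 * ∑ d ∈ adjPairs G, x d.1 * x d.2 := by
  classical
  rw [dotProduct_mulVec_eq_sum, ← sum_weight_eq]
  exact Finset.sum_le_sum fun u _ => Finset.sum_le_sum fun v _ =>
    mul_le_mul_of_nonneg_right (hararyMatrix_apply_le hG u v) (mul_pos (hx u) (hx v)).le

theorem rayleigh_pendantClique (c : V) (R : Set V) (x : V → ℝ) :
    x ⬝ᵥ (hararyMatrix (pendantClique c R) *ᵥ x) =
      (∑ u, ∑ v, (if u = v then 0 else 1 / 2) * (x u * x v)) +
        1 / 2 * ∑ d ∈ adjPairs (pendantClique c R), x d.1 * x d.2 := by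
  classical
  rw [dotProduct_mulVec_eq_sum, ← sum_weight_eq]
  simp only [hararyMatrix_pendantClique_apply]

/-- In a positive eigenvector of the Harary matrix, the entry at `c` exceeds the entry at every
vertex that misses another vertex. -/
theorem eigenvector_lt_base {R : Set V} {r : ℝ} (hr : 0 ≤ r) (hx : ∀ v, 0 < x v)
    (he : hararyMatrix (pendantClique c R) *ᵥ x = r • x) {u w : V}
    (huw : u ≠ w) (hadj : ¬ (pendantClique c R).Adj u w) : x u < x c := by
  classical
  have hmc : ∀ v, v ≠ c → hararyMatrix (pendantClique c R) c v = 1 := fun v hv => by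
    simp [hararyMatrix, hv.symm, dist_eq_one_iff_adj.2 (pendantClique_base_adj (R := R) hv)]
  have hmu : ∀ v, hararyMatrix (pendantClique c R) u v ≤ 1 := fun v => by
    rw [hararyMatrix_pendantClique_apply]
    split_ifs <;> norm_num
  -- With 1 added on the diagonal, row `c` is all ones and dominates row `u`, strictly at `w`. The
  -- eigenvector equations turn this into `(r + 1) * x u < (r + 1) * x c`.
  have hsum : ∑ v, (hararyMatrix (pendantClique c R) c v + if v = c then 1 else 0) * x v >
      ∑ v, (hararyMatrix (pendantClique c R) u v + if v = u then 1 else 0) * x v := by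
    have h1 : ∀ v, (hararyMatrix (pendantClique c R) c v + if v = c then 1 else 0) = 1 := by
      intro v
      by_cases hv : v = c
      · simp [hv, hararyMatrix]
      · simp [hv, hmc v hv]
    refine Finset.sum_lt_sum (fun v _ => mul_le_mul_of_nonneg_right ?_ (hx v).le)
      ⟨w, Finset.mem_univ _, mul_lt_mul_of_pos_right ?_ (hx w)⟩
    · rw [h1]
      by_cases hv : v = u
      · simp [hv, hararyMatrix]
      · simpa [hv] using hmu v
    · rw [h1, hararyMatrix_pendantClique_apply]
      norm_num [huw, huw.symm, hadj]
  have hc' := congrFun he c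
  have hu' := congrFun he u
  simp only [mulVec, dotProduct, Pi.smul_apply, smul_eq_mul] at hc' hu'
  simp only [add_mul, Finset.sum_add_distrib, ite_mul, one_mul, zero_mul, Finset.sum_ite_eq',
    Finset.mem_univ, if_true, hc', hu'] at hsum
  nlinarith

/-- Some clique with pendant vertices on the vertices of `G`, with as many cut edges as `G`,
dominates `G`, strictly unless it is `G`. -/
theorem exists_pendantClique_dominating (hG : G.Connected) :
    ∃ (c : V) (R : Set V), c ∉ R ∧ Rᶜ.ncard ≠ 2 ∧ R.ncard = (cutEdges G).ncard ∧
      hararySpectralRadius G ≤ hararySpectralRadius (pendantClique c R) ∧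
      (hararySpectralRadius (pendantClique c R) ≤ hararySpectralRadius G →
        G = pendantClique c R) := by
  have := hG.nonempty
  obtain ⟨r, hr, hrad, ⟨x, hx, hxr⟩, -⟩ := exists_harary_perron hG
  obtain ⟨c, -, hc⟩ := Finset.exists_max_image Finset.univ x Finset.univ_nonempty
  replace hc : ∀ v, x v ≤ x c := fun v => hc v (Finset.mem_univ v)
  obtain ⟨s, hs, hsrad, -, hmax⟩ :=
    exists_harary_perron (pendantClique_connected (c := c) (R := farEnds G c))
  have h1 := rayleigh_le hG hx
  have h2 := sum_adjPairs_le hG hx hc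
  have h3 := rayleigh_pendantClique c (farEnds G c) x
  have h4 := (hmax x).1
  have hpos : 0 < x ⬝ᵥ x :=
    Finset.sum_pos (fun v _ => mul_pos (hx v) (hx v)) Finset.univ_nonempty
  refine ⟨c, farEnds G c, base_notMem_farEnds, ncard_compl_farEnds_ne_two hG c,
    ncard_farEnds hG c, ?_, fun hle => ?_⟩
  · rw [hrad, hsrad]
    refine ENNReal.ofReal_le_ofReal (le_of_mul_le_mul_right ?_ hpos)
    linarith
  · rw [hrad, hsrad, ENNReal.ofReal_le_ofReal_iff hr] at hle
    have h5 := mul_le_mul_of_nonneg_right hle hpos.le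
    -- The chain from `r * (x ⬝ᵥ x)` through both quadratic forms to `s * (x ⬝ᵥ x)` closes up, so
    -- every inequality in it is an equality.
    have he := (hmax x).2 (by linarith)
    exact eq_pendantClique_of_sum_eq hG hx hc
      (fun u v huv ha => eigenvector_lt_base hs hx he huv ha) (by linarith)

end Comparison

theorem theorem5p3 (n p : ℕ) {V : Type*} [Fintype V] [DecidableEq V] (G : SimpleGraph V)
    (hG : IsConnectedWithCutEdges n p G) :
    IsConnectedWithCutEdges n p (completeWithPendants (n - p) p) ∧
    hararySpectralRadius G ≤ hararySpectralRadius (completeWithPendants (n - p) p) ∧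
    ((∀ H : SimpleGraph V, IsConnectedWithCutEdges n p H →
        hararySpectralRadius H ≤ hararySpectralRadius G) ↔
      Nonempty (G ≃g completeWithPendants (n - p) p)) := by
  have key : ∀ H : SimpleGraph V, IsConnectedWithCutEdges n p H →
      ∃ K : SimpleGraph V, IsConnectedWithCutEdges n p K ∧
        Nonempty (K ≃g completeWithPendants (n - p) p) ∧
        hararySpectralRadius H ≤ hararySpectralRadius K ∧
        (hararySpectralRadius K ≤ hararySpectralRadius H → H = K) := by
    intro H hH
    obtain ⟨c, R, hc, h2, hR, hle, heq⟩ := exists_pendantClique_dominating hH.connected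
    rw [hH.ncard_cutEdges] at hR
    have hK := isConnectedWithCutEdges_pendantClique hc h2
    rw [hH.card_eq, hR] at hK
    exact ⟨_, hK, nonempty_iso_completeWithPendants hc hH.card_eq hR, hle, heq⟩
  have hle : ∀ H : SimpleGraph V, IsConnectedWithCutEdges n p H →
      hararySpectralRadius H ≤ hararySpectralRadius (completeWithPendants (n - p) p) := by
    intro H hH
    obtain ⟨K, hK, ⟨f⟩, h, -⟩ := key H hH
    rwa [← hararySpectralRadius_eq_of_iso f hK.connected]
  obtain ⟨K, hK, ⟨f⟩, -, heq⟩ := key G hG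
  refine ⟨hK.of_iso f, hle G hG, fun h => ?_, fun ⟨g⟩ H hH => ?_⟩
  · rw [heq (h K hK)]
    exact ⟨f⟩
  · rw [hararySpectralRadius_eq_of_iso g hG.connected]
    exact hle H hH
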